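/- A monoid is a commutative cancellative semigroup with identity. Let $H$ be a monoid with quotient group $Q$ and group of units $H^\times$. An atom of $H$ is a non-unit that is not a product of two non-units; $H$ is atomic if every non-unit is a finite product of atoms. For a non-unit $a$ let $\mathsf L(a)$ be the set of all $k\in\mathbb N$ such that $a$ is a product of $k$ atoms, and let $\mathsf L(a)=\{0\}$ for a unit $a$. The monoid $H$ is half-factorial if it is atomic and $|\mathsf L(a)|=1$ for all $a\in H$. For $A\subseteq Q$ put $A^{-1}=\{z\in Q\mid zA\subseteq H\}$, $A_v=(A^{-1})^{-1}$ and $A_t=\bigcup_{E\subseteq A,\,|E|<\infty}E_v$; a $t$-ideal of $H$ is a subset $A\subseteq H$ with $A_t=A$. The monoid $H$ is a Krull monoid if it satisfies the ascending chain condition on $t$-ideals and is completely integrally closed, that is, every $x\in Q$ for which there is some $c\in H$ with $cx^n\in H$ for all $n\in\mathbb N$ lies in $H$. A monoid homomorphism $\theta\colon H\to B$ is a transfer homomorphism if $B=\theta(H)B^\times$, $\theta^{-1}(B^\times)=H^\times$, and whenever $u\in H$, $b,c\in B$ and $\theta(u)=bc$, there are $v,w\in H$ and $\varepsilon,\eta\in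 B^\times$ with $u=vw$, $\theta(v)=b\varepsilon$ and $\theta(w)=c\eta$. The monoid $H$ is transfer Krull if there is a transfer homomorphism from $H$ to some Krull monoid. For an integral domain $R$ let $R^\bullet=R\setminus\{0\}$ be its multiplicative monoid of nonzero elements and let $\overline R$ be its integral closure in its quotient field; $R$ is called half-factorial, transfer Krull or atomic if $R^\bullet$ is. A Cohen--Kaplansky domain is an atomic integral domain that has only finitely many atoms up to associates. **Proposition.** Let $R$ be a local Cohen--Kaplansky domain with maximal ideal $M$. Then the following conditions are equivalent. 1. $R$ is half-factorial. 2. $R$ is transfer Krull. 3. The inclusion $R^\bullet\hookrightarrow\overline R^\bullet$ is a transfer homomorphism. If these equivalent conditions hold, then $M\overline R=\overline R\setminus\overline R^\times$, both for $M\overline R$ the ideal of $\overline R$ generated by $M$ and for $M\overline R=\{my\mid m\in M,\ y\in\overline R\}$. -/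

import Mathlib

open scoped nonZeroDivisors

universe u v w

namespace CK

/-! ### Factorizations in monoids -/

section Factorization

variable (H : Type u) [CommMonoid H]

/-- Every non-unit is a finite product of atoms. (The atoms of a monoid are its `Irreducible`
elements: the non-units that are not a product of two non-units.) -/
def IsAtomicMonoid : Prop :=
  ∀ a : H, ¬ IsUnit a → ∃ s : Multiset H, (∀ p ∈ s, Irreducible p) ∧ s.prod = a

variable {H} in
/-- The set of lengths of `a`: it is `{0}` if `a` is a unit; otherwise it is the set of all `k` such
that `a` is a product of `k` atoms (such a `k` is positive, since the empty product is a unit). -/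
def lengths (a : H) : Set ℕ :=
  {k | (IsUnit a ∧ k = 0) ∨
    (¬ IsUnit a ∧ ∃ s : Multiset H, Multiset.card s = k ∧ (∀ p ∈ s, Irreducible p) ∧ s.prod = a)}

/-- Atomic, and each element has exactly one factorization length. -/
def IsHalfFactorial : Prop :=
  IsAtomicMonoid H ∧ ∀ a : H, (lengths a).ncard = 1

end Factorization

/-! ### Krull monoids -/

section Ideals

variable {K : Type u} [CommGroup K]

/-- The complete integral closure of a submonoid `H` of a group `K`. -/
def complIntClosure (H : Submonoid K) : Set K :=
  {x | ∃ c ∈ H, ∀ n : ℕ, 0 < n → c * x ^ n ∈ H}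

/-- `A⁻¹ = (H : A) = {z ∈ K | z A ⊆ H}`. -/
def idealInv (H : Submonoid K) (A : Set K) : Set K :=
  {z | ∀ a ∈ A, z * a ∈ H}

/-- The `v`-closure `A_v = (A⁻¹)⁻¹`. -/
def vClosure (H : Submonoid K) (A : Set K) : Set K :=
  idealInv H (idealInv H A)

/-- The `t`-closure `A_t`: the union of all `E_v`, where `E` is a finite subset of `A`. -/
def tClosure (H : Submonoid K) (A : Set K) : Set K :=
  {x | ∃ E : Set K, E.Finite ∧ E ⊆ A ∧ x ∈ vClosure H E}

/-- `A` is a `t`-ideal of `H`. -/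
def IsTIdeal (H : Submonoid K) (A : Set K) : Prop :=
  A ⊆ (H : Set K) ∧ tClosure H A = A

/-- The ascending chain condition on `t`-ideals. -/
def IsMoriIn (H : Submonoid K) : Prop :=
  ∀ f : ℕ → Set K, Monotone f → (∀ n, IsTIdeal H (f n)) → ∃ N, ∀ n, N ≤ n → f n = f N

end Ideals

/-- A Krull monoid: a completely integrally closed Mori monoid. The monoid `B` is viewed as a
submonoid of its quotient group. -/
def IsKrullMonoid (B : Type u) [CancelCommMonoid B] : Prop :=
  let H : Submonoid (Algebra.GrothendieckGroup B) :=
    MonoidHom.mrange (Algebra.GrothendieckGroup.of (M := B))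
  complIntClosure H = (H : Set (Algebra.GrothendieckGroup B)) ∧ IsMoriIn H

/-! ### Transfer homomorphisms -/

/-- Transfer homomorphisms of monoids; the first two fields are property (T1), that is
`B = θ(H) Bˣ` and `θ⁻¹(Bˣ) = Hˣ`, the last one is property (T2). -/
structure IsTransferHom {H : Type u} {B : Type v} [CommMonoid H] [CommMonoid B]
    (θ : H →* B) : Prop where
  exists_eq_mul_unit : ∀ b : B, ∃ (h : H) (ε : Bˣ), b = θ h * ε
  isUnit_iff : ∀ h : H, IsUnit (θ h) ↔ IsUnit h
  exists_lift : ∀ (u : H) (b c : B), θ u = b * c →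
    ∃ (v w : H) (ε η : Bˣ), u = v * w ∧ θ v = b * ε ∧ θ w = c * η

/-- There is a transfer homomorphism to a Krull monoid. -/
def IsTransferKrull (H : Type u) [CommMonoid H] : Prop :=
  ∃ (B : Type v) (_ : CancelCommMonoid B),
    IsKrullMonoid B ∧ ∃ θ : H →* B, IsTransferHom θ

/-! ### Domains -/

/-- A Cohen-Kaplansky domain: the multiplicative monoid `R⁰` of nonzero elements is atomic and has
only finitely many atoms up to associates. -/
def IsCohenKaplansky (R : Type u) [CommRing R] [IsDomain R] : Prop :=
  IsAtomicMonoid R⁰ ∧ {x : Associates R⁰ | ∃ p : R⁰, Irreducible p ∧ Associates.mk p = x}.Finite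

/-- The inclusion of the monoid of nonzero elements of a domain `A` in that of an extension
domain `B`. -/
def nonzeroInclusion (A : Type u) (B : Type v) [CommRing A] [IsDomain A] [CommRing B] [IsDomain B]
    [Algebra A B] [FaithfulSMul A B] : A⁰ →* B⁰ where
  toFun a := ⟨algebraMap A B a, mem_nonZeroDivisors_of_ne_zero fun h =>
    nonZeroDivisors.coe_ne_zero a
      ((map_eq_zero_iff _ (FaithfulSMul.algebraMap_injective A B)).1 h)⟩
  map_one' := by ext; simp
  map_mul' a b := by ext; simp

end CK

namespace CK

/-! ### Finitely generated primary monoids -/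

section PrimaryMonoid

variable {D : Type u} [CommMonoid D]

/-! Modulo units, `R⁰` is a finitely generated primary monoid. Each prime ideal is generated by the
atoms it contains, so `R` is Noetherian with finitely many primes; prime avoidance and Krull's
principal ideal theorem then leave no nonzero prime but the maximal ideal, and every element divides
a power of every non-unit.

In such a monoid all elements have powers that are powers of a single generator `a`. With a uniform
exponent, `x ^ m = a ^ V x` up to a unit, which defines an additive value `V`. Two facts make `V`
useful: `V y ≤ V x` gives `y ^ m ∣ x ^ m`, so `x / y` is integral over `R`, and `V y + N ≤ V x`
gives `y ∣ x` already in `R`. Thus `V` decides divisibility of elements of `R` inside the integral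
closure, and decides it in `R` up to a bounded error.

Each of the three conditions is equivalent to all atoms having one common value. Given that, lengths
are read off from `V`, and subproducts of a factorization realise every possible smaller value, so
factorizations lift from the value monoid and from the integral closure. Conversely, atoms of
different values yield factorizations of different lengths, and under a transfer homomorphism to a
Krull monoid or to the integral closure their images would be associated, which is absurd. -/

theorem exists_pow_mem_closure {S A : Set D}
    (h : ∀ x ∈ A, ∃ m : ℕ, 0 < m ∧ x ^ m ∈ Submonoid.closure S) {x : D}
    (hx : x ∈ Submonoid.closure A) : ∃ m : ℕ, 0 < m ∧ x ^ m ∈ Submonoid.closure S := by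
  induction hx using Submonoid.closure_induction with
  | mem x hx => exact h x hx
  | one => exact ⟨1, one_pos, by simp⟩
  | mul x y _ _ hx hy =>
    obtain ⟨m, hm, hxm⟩ := hx
    obtain ⟨n, hn, hyn⟩ := hy
    refine ⟨m * n, Nat.mul_pos hm hn, ?_⟩
    rw [mul_pow, pow_mul, mul_comm m n, pow_mul]
    exact mul_mem (pow_mem hxm _) (pow_mem hyn _)

theorem eq_one_of_pow_eq_one (hD : ∀ x : D, IsUnit x → x = 1) {x : D} {m : ℕ} (hm : 0 < m)
    (h : x ^ m = 1) : x = 1 :=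
  hD x (IsUnit.of_pow_eq_one h hm.ne')

/-- A common exponent for all elements. -/
theorem exists_uniform_power {A : Set D} (hfin : A.Finite) (hA : Submonoid.closure A = ⊤) {a : D}
    (h : ∀ x : D, ∃ m : ℕ, 0 < m ∧ ∃ k : ℕ, x ^ m = a ^ k) :
    ∃ m : ℕ, 0 < m ∧ ∀ x : D, ∃ k : ℕ, x ^ m = a ^ k := by
  choose e he k hk using h
  refine ⟨∏ x ∈ hfin.toFinset, e x, Finset.prod_pos fun x _ => he x, fun x => ?_⟩
  have hx : x ∈ Submonoid.closure A := hA ▸ Submonoid.mem_top x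
  induction hx using Submonoid.closure_induction with
  | mem x hx =>
    obtain ⟨c, hc⟩ := Finset.dvd_prod_of_mem e (hfin.mem_toFinset.2 hx)
    exact ⟨k x * c, by rw [hc, pow_mul, hk, pow_mul]⟩
  | one => exact ⟨0, by simp⟩
  | mul x y _ _ hx hy =>
    obtain ⟨i, hi⟩ := hx
    obtain ⟨j, hj⟩ := hy
    exact ⟨i + j, by rw [mul_pow, hi, hj, pow_add]⟩

variable [IsCancelMul D]

/-- In a reduced primary monoid generated by a finite set of nontrivial elements, all elements have
a power that is a power of one fixed generator. -/
theorem exists_generator_up_to_powers (hD : ∀ x : D, IsUnit x → x = 1) {A : Set D}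
    (hfin : A.Finite) (hA : Submonoid.closure A = ⊤) (h1 : (1 : D) ∉ A) (hne : A.Nonempty)
    (hprim : ∀ a ∈ A, ∀ b ∈ A, ∃ n : ℕ, a ∣ b ^ n) :
    ∃ a ∈ A, ∀ x : D, ∃ m : ℕ, 0 < m ∧ ∃ k : ℕ, x ^ m = a ^ k := by
  classical
  -- `P S` says that `S` generates `A` up to powers. A minimal such `S` turns out to be a singleton.
  let P : Set D → Prop := fun S =>
    S ⊆ A ∧ ∀ x ∈ A, ∃ m : ℕ, 0 < m ∧ x ^ m ∈ Submonoid.closure S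
  have hP : {S | P S}.Finite := hfin.finite_subsets.subset fun S hS => hS.1
  obtain ⟨S, hSmin⟩ := hP.exists_minimal
    ⟨A, subset_rfl, fun x hx => ⟨1, one_pos, by simpa using Submonoid.subset_closure hx⟩⟩
  obtain ⟨hSA, hS⟩ : P S := hSmin.prop
  have hall : ∀ x : D, ∃ m : ℕ, 0 < m ∧ x ^ m ∈ Submonoid.closure S := fun x =>
    exists_pow_mem_closure hS (by rw [hA]; trivial)
  have hSne : S.Nonempty := by
    rw [Set.nonempty_iff_ne_empty]
    rintro rfl
    obtain ⟨x, hx⟩ := hne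
    obtain ⟨m, hm, hxm⟩ := hS x hx
    rw [Submonoid.closure_empty, Submonoid.mem_bot] at hxm
    exact h1 (eq_one_of_pow_eq_one hD hm hxm ▸ hx)
  obtain ⟨a, ha⟩ := hSne
  have hdecomp : ∀ x ∈ Submonoid.closure S,
      ∃ k : ℕ, ∃ t ∈ Submonoid.closure (S \ {a}), x = a ^ k * t := by
    intro x hx
    rw [← Set.insert_sdiff_self_of_mem ha, Set.insert_eq, Submonoid.closure_union,
      Submonoid.mem_sup] at hx
    obtain ⟨y, hy, t, ht, rfl⟩ := hx
    obtain ⟨k, rfl⟩ := Submonoid.mem_closure_singleton.1 hy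
    exact ⟨k, t, ht, rfl⟩
  have hSa : ∀ b ∈ S, b = a := by
    intro b hb
    by_contra hba
    obtain ⟨N, y, hy⟩ := hprim b (hSA hb) a (hSA ha)
    obtain ⟨m, hm, hym⟩ := hall y
    obtain ⟨k, t, ht, hkt⟩ := hdecomp _ hym
    have key : a ^ (N * m) = b ^ m * (a ^ k * t) := by rw [pow_mul, hy, mul_pow, hkt]
    have hbm : b ^ m * t ∈ Submonoid.closure (S \ {a}) :=
      by
      have hbS : b ∈ S \ {a} := ⟨hb, hba⟩
      exact mul_mem (pow_mem (Submonoid.subset_closure hbS) _) ht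
    -- Cancelling powers of `a` in `key` either writes a positive power of `a` through `S \ {a}`,
    -- against minimality, or makes `b` a unit.
    rcases lt_or_ge k (N * m) with hk | hk
    · have hpow : a ^ (N * m - k) = b ^ m * t := by
        apply mul_left_cancel (a := a ^ k)
        rw [← pow_add, Nat.add_sub_cancel' hk.le, key]
        exact mul_left_comm _ _ _
      have hPS : P (S \ {a}) := by
        refine ⟨Set.sdiff_subset.trans hSA, fun x hx => ?_⟩
        obtain ⟨n, hn, hxn⟩ := hS x hx
        obtain ⟨j, s, hs, hxs⟩ := hdecomp _ hxn
        refine ⟨n * (N * m - k), Nat.mul_pos hn (Nat.sub_pos_of_lt hk), ?_⟩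
        rw [pow_mul, hxs, mul_pow, ← pow_mul, mul_comm j, pow_mul, hpow]
        exact mul_mem (pow_mem hbm _) (pow_mem hs _)
      exact (hSmin.le_of_le hPS Set.sdiff_subset ha).2 rfl
    · have hpow : 1 = b ^ m * (a ^ (k - N * m) * t) := by
        apply mul_left_cancel (a := a ^ (N * m))
        rw [mul_one, mul_left_comm, ← mul_assoc (a ^ (N * m)), ← pow_add,
          Nat.add_sub_cancel' hk, key]
      have hb1 : b = 1 :=
        hD b (isUnit_of_dvd_one ((dvd_pow_self b hm.ne').trans ⟨_, hpow⟩))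
      exact h1 (hb1 ▸ hSA hb)
  refine ⟨a, hSA ha, fun x => ?_⟩
  obtain ⟨m, hm, hxm⟩ := hall x
  obtain ⟨k, t, ht, hkt⟩ := hdecomp _ hxm
  have : S \ {a} = ∅ := Set.sdiff_eq_empty.2 hSa
  rw [this, Submonoid.closure_empty, Submonoid.mem_bot] at ht
  exact ⟨m, hm, k, by rw [hkt, ht, mul_one]⟩

theorem pow_left_injective_of_ne_one (hD : ∀ x : D, IsUnit x → x = 1) {a : D} (ha : a ≠ 1)
    {k l : ℕ} (h : a ^ k = a ^ l) : k = l := by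
  wlog hkl : k ≤ l generalizing k l
  · exact (this h.symm (le_of_not_ge hkl)).symm
  by_contra hne
  refine ha (eq_one_of_pow_eq_one hD (m := l - k) (by omega) ?_)
  apply mul_left_cancel (a := a ^ k)
  rw [← pow_add, Nat.add_sub_cancel' hkl, mul_one, h]

/-- The structure of a reduced finitely generated primary monoid: it has a value homomorphism to
the natural numbers, which governs divisibility up to a bounded error. -/
theorem exists_value_hom_of_fg_primary (hD : ∀ x : D, IsUnit x → x = 1) {A : Set D}
    (hfin : A.Finite) (hA : Submonoid.closure A = ⊤) (h1 : (1 : D) ∉ A)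
    (hprim : ∀ a ∈ A, ∀ b ∈ A, ∃ n : ℕ, a ∣ b ^ n) :
    ∃ (V : D → ℕ) (N m : ℕ), 0 < m ∧ (∀ x y, V (x * y) = V x + V y) ∧ (∀ x, V x = 0 ↔ x = 1) ∧
      (∀ x y, V y + N ≤ V x → y ∣ x) ∧ (∀ x y, V y ≤ V x → y ^ m ∣ x ^ m) := by
  classical
  rcases A.eq_empty_or_nonempty with rfl | hne
  · have htriv : ∀ x : D, x = 1 := fun x => by
      rw [← Submonoid.mem_bot, ← Submonoid.closure_empty, hA]; trivial
    refine ⟨fun _ => 0, 0, 1, one_pos, fun _ _ => rfl, fun x => ⟨fun _ => htriv x, fun _ => rfl⟩,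
      fun x y _ => ?_, fun x y _ => ?_⟩ <;> simp [htriv x, htriv y]
  obtain ⟨a, haA, ha⟩ := exists_generator_up_to_powers hD hfin hA h1 hne hprim
  obtain ⟨m, hm, hpow⟩ := exists_uniform_power hfin hA ha
  have ha1 : a ≠ 1 := fun h => h1 (h ▸ haA)
  choose V hV using hpow
  have hinj : ∀ {k l : ℕ}, a ^ k = a ^ l → k = l := pow_left_injective_of_ne_one hD ha1
  have hmul : ∀ x y, V (x * y) = V x + V y := fun x y => hinj (by
    rw [← hV, mul_pow, hV, hV, pow_add])
  have hone : V 1 = 0 := hinj (by rw [← hV, one_pow, pow_zero])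
  have hVa : V a = m := hinj (hV a).symm
  have hVpow : ∀ (x : D) (n : ℕ), V (x ^ n) = n * V x := by
    intro x n
    induction n with
    | zero => simp [hone]
    | succ n ih => rw [pow_succ, hmul, ih, Nat.succ_mul]
  have hVprod : ∀ f : D → D, V (∏ i ∈ hfin.toFinset, f i) = ∑ i ∈ hfin.toFinset, V (f i) := by
    intro f
    induction hfin.toFinset using Finset.induction_on with
    | empty => simp [hone]
    | insert i s hi ih => rw [Finset.prod_insert hi, Finset.sum_insert hi, hmul, ih]
  -- This bounds the value of what remains after reducing all exponents of generators modulo `m`;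
  -- the quotients are absorbed into a power of `a` because `i ^ m = a ^ V i`.
  set N := ∑ i ∈ hfin.toFinset, m * V i with hN
  have hrep : ∀ z : D, ∃ (q : ℕ) (f : D), z = a ^ q * f ∧ V f ≤ N := by
    intro z
    have hz : z ∈ Submonoid.closure (hfin.toFinset : Set D) := by
      rw [hfin.coe_toFinset, hA]; trivial
    obtain ⟨n, -, rfl⟩ := Submonoid.mem_closure_finset.1 hz
    refine ⟨∑ i ∈ hfin.toFinset, V i * (n i / m), ∏ i ∈ hfin.toFinset, i ^ (n i % m), ?_, ?_⟩
    · rw [← Finset.prod_pow_eq_pow_sum, ← Finset.prod_mul_distrib]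
      refine Finset.prod_congr rfl fun i _ => ?_
      rw [pow_mul, ← hV, ← pow_mul, ← pow_add, Nat.div_add_mod]
    · rw [hVprod, hN]
      refine Finset.sum_le_sum fun i _ => ?_
      rw [hVpow]
      exact Nat.mul_le_mul_right _ (Nat.mod_lt _ hm).le
  refine ⟨V, N + 1, m, hm, hmul, fun x => ⟨fun hx => ?_, fun hx => hx ▸ hone⟩, fun x y hxy => ?_,
    fun x y hxy => ?_⟩
  · exact eq_one_of_pow_eq_one hD hm (by rw [hV, hx, pow_zero])
  -- Since `y ^ m = a ^ V y`, it suffices that `q ≥ V y`: then `y ^ m` divides `x * y ^ (m - 1)`,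
  -- and `y ^ (m - 1)` cancels. The remainder `f` has value at most `N`, so a smaller `q` would make
  -- `V x` too small.
  · obtain ⟨q, f, hqf, hf⟩ := hrep (x * y ^ (m - 1))
    have hval : V x + (m - 1) * V y = q * m + V f := by
      rw [← hVpow, ← hmul, hqf, hmul, hVpow, hVa]
    have hq : V y ≤ q := by
      by_contra! hlt
      have h2 : (q + 1) * m ≤ V y * m := Nat.mul_le_mul_right _ hlt
      obtain ⟨m, rfl⟩ := Nat.exists_eq_succ_of_ne_zero hm.ne'
      simp only [Nat.succ_eq_add_one, Nat.add_sub_cancel] at *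
      nlinarith
    have hdvd : y ^ (m - 1) * y ∣ y ^ (m - 1) * x := by
      rw [← pow_succ, Nat.sub_add_cancel hm, hV, mul_comm _ x, hqf]
      exact (pow_dvd_pow a hq).mul_right f
    obtain ⟨c, hc⟩ := hdvd
    exact ⟨c, mul_left_cancel (a := y ^ (m - 1)) (by rw [hc, mul_assoc])⟩
  · rw [hV, hV]
    exact pow_dvd_pow a hxy

end PrimaryMonoid

/-! ### Local Cohen-Kaplansky domains -/

section LocalDomain

variable {R : Type u} [CommRing R] [IsDomain R]

theorem isUnit_coe_nonZeroDivisors_iff {a : R⁰} : IsUnit (a : R) ↔ IsUnit a := by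
  refine ⟨fun h => ?_, fun h => h.map (Submonoid.subtype R⁰)⟩
  obtain ⟨b, hb⟩ := h.exists_right_inv
  have hb0 : b ≠ 0 := by rintro rfl; simp at hb
  exact IsUnit.of_mul_eq_one ⟨b, mem_nonZeroDivisors_of_ne_zero hb0⟩ (Subtype.ext hb)

theorem isCancelMul_nonZeroDivisors : IsCancelMul R⁰ :=
  @CommMagma.IsLeftCancelMul.toIsCancelMul _ _ ⟨fun a _ _ h => Subtype.ext
    (mul_left_cancel₀ (nonZeroDivisors.coe_ne_zero a) (congrArg Subtype.val h))⟩

/-- A finite set of representatives of the atoms. -/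
theorem IsCohenKaplansky.exists_finite_atoms (hR : IsCohenKaplansky R) :
    ∃ A : Set R⁰, A.Finite ∧ ∀ q : R⁰, Irreducible q → ∃ p ∈ A, Associated p q := by
  refine ⟨Quotient.out '' {x : Associates R⁰ | ∃ p : R⁰, Irreducible p ∧ Associates.mk p = x},
    hR.2.image _, fun q hq => ⟨_, ⟨_, ⟨q, hq, rfl⟩, rfl⟩, ?_⟩⟩
  exact Associates.mk_quot_out q

/-- Prime ideals are determined by the atoms that they contain. -/
theorem IsAtomicMonoid.eq_span_atoms (hR : IsAtomicMonoid R⁰) {A : Set R⁰}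
    (hA : ∀ q : R⁰, Irreducible q → ∃ p ∈ A, Associated p q) (P : Ideal R) [P.IsPrime] :
    P = Ideal.span (((↑) : R⁰ → R) '' {p ∈ A | (p : R) ∈ P}) := by
  refine le_antisymm (fun x hx => ?_) (Ideal.span_le.2 (by rintro _ ⟨p, hp, rfl⟩; exact hp.2))
  by_cases hx0 : x = 0
  · simp [hx0]
  have hxu : ¬ IsUnit (⟨x, mem_nonZeroDivisors_of_ne_zero hx0⟩ : R⁰) := fun h =>
    ‹P.IsPrime›.ne_top (Ideal.eq_top_of_isUnit_mem _ hx (isUnit_coe_nonZeroDivisors_iff.2 h))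
  obtain ⟨s, hs, hsx⟩ := hR _ hxu
  have hsx' : (s.map (Submonoid.subtype R⁰)).prod = x := by
    rw [← map_multiset_prod, hsx]; rfl
  rw [← hsx', Ideal.IsPrime.multiset_prod_mem_iff_exists_mem ‹_›] at hx
  obtain ⟨_, hq, hqP⟩ := hx
  obtain ⟨q, hqs, rfl⟩ := Multiset.mem_map.1 hq
  obtain ⟨p, hpA, hpq⟩ := hA q (hs q hqs)
  have hpq' : Associated (p : R) q := hpq.map (Submonoid.subtype R⁰)
  have hpP : (p : R) ∈ P := P.mem_of_dvd hpq'.symm.dvd hqP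
  rw [← hsx']
  exact Ideal.mem_of_dvd _ (hpq'.dvd.trans (Multiset.dvd_prod hq))
    (Ideal.subset_span ⟨p, ⟨hpA, hpP⟩, rfl⟩)

/-- By Cohen's theorem only prime ideals need finite generation, and these are generated by
representatives of the atoms. -/
theorem IsCohenKaplansky.isNoetherianRing (hR : IsCohenKaplansky R) : IsNoetherianRing R := by
  obtain ⟨A, hfin, hA⟩ := hR.exists_finite_atoms
  refine IsNoetherianRing.of_prime fun P hP => ?_
  rw [hR.1.eq_span_atoms hA P]
  exact Submodule.fg_span ((hfin.subset (Set.sep_subset _ _)).image _)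

theorem IsCohenKaplansky.finite_primes (hR : IsCohenKaplansky R) :
    {P : Ideal R | P.IsPrime}.Finite := by
  obtain ⟨A, hfin, hA⟩ := hR.exists_finite_atoms
  refine Set.Finite.of_injOn (f := fun P : Ideal R => {p ∈ A | (p : R) ∈ P})
    (t := {S | S ⊆ A}) (fun P _ => Set.sep_subset _ _) (fun P hP Q hQ h => ?_) hfin.finite_subsets
  have : P.IsPrime := hP
  have : Q.IsPrime := hQ
  rw [hR.1.eq_span_atoms hA P, hR.1.eq_span_atoms hA Q]
  exact congrArg (fun S => Ideal.span (((↑) : R⁰ → R) '' S)) h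

variable [IsLocalRing R]

/-- A local Noetherian domain with finitely many primes has dimension at most one. -/
theorem eq_maximalIdeal_of_finite_primes [IsNoetherianRing R]
    (hfin : {P : Ideal R | P.IsPrime}.Finite) (P : Ideal R) [P.IsPrime] (hP : P ≠ ⊥) :
    P = IsLocalRing.maximalIdeal R := by
  by_contra hPM
  have hlt : P < IsLocalRing.maximalIdeal R :=
    lt_of_le_of_ne (IsLocalRing.le_maximalIdeal ‹P.IsPrime›.ne_top) hPM
  have hS : {Q : Ideal R | Q.IsPrime ∧ Q ≠ IsLocalRing.maximalIdeal R}.Finite :=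
    hfin.subset fun Q hQ => hQ.1
  -- Prime avoidance yields `x` in the maximal ideal and in no other prime. The maximal ideal is
  -- then minimal over `x`, hence of height at most one, and `P` strictly below it has height zero.
  have hsub : ¬ ((IsLocalRing.maximalIdeal R : Set R) ⊆
      ⋃ Q ∈ {Q : Ideal R | Q.IsPrime ∧ Q ≠ IsLocalRing.maximalIdeal R}, (Q : Set R)) := by
    intro h
    obtain ⟨Q, hQ, hle⟩ := (Ideal.subset_union_prime_finite hS (f := fun Q => Q) ⊥ ⊥
      fun Q hQ _ _ => hQ.1).1 h
    exact hQ.2 (le_antisymm (IsLocalRing.le_maximalIdeal hQ.1.ne_top) hle)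
  obtain ⟨x, hxM, hx⟩ := Set.not_subset.1 hsub
  simp only [Set.mem_iUnion, not_exists] at hx
  have hmin : IsLocalRing.maximalIdeal R ∈ (Ideal.span {x}).minimalPrimes := by
    refine ⟨⟨inferInstance, (Ideal.span_singleton_le_iff_mem _).2 hxM⟩, fun Q hQ _ => ?_⟩
    by_contra hne
    exact hx Q ⟨hQ.1, fun h => hne h.ge⟩ ((Ideal.span_singleton_le_iff_mem _).1 hQ.2)
  have hht := Ideal.height_le_one_of_isPrincipal_of_mem_minimalPrimes _ _ hmin
  have h0 : P.height < 1 := Ideal.height_le_iff.1 hht P ‹_› hlt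
  rw [Order.lt_one_iff, Ideal.height_eq_zero_iff, IsDomain.minimalPrimes_eq_singleton_bot] at h0
  exact hP h0

/-- A local Cohen-Kaplansky domain is primary. -/
theorem IsCohenKaplansky.exists_dvd_pow (hR : IsCohenKaplansky R) (a b : R⁰) (hb : ¬ IsUnit b) :
    ∃ n : ℕ, a ∣ b ^ n := by
  have := hR.isNoetherianRing
  -- Every prime containing `a` is nonzero, hence maximal, hence contains the non-unit `b`.
  have hrad : (b : R) ∈ (Ideal.span {(a : R)}).radical := by
    rw [Ideal.radical_eq_sInf, Ideal.mem_sInf]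
    rintro P ⟨haP, hP⟩
    have hne : P ≠ ⊥ := by
      rintro rfl
      simp at haP
    rw [eq_maximalIdeal_of_finite_primes hR.finite_primes P hne, IsLocalRing.mem_maximalIdeal,
      mem_nonunits_iff, isUnit_coe_nonZeroDivisors_iff]
    exact hb
  obtain ⟨n, hn⟩ := hrad
  obtain ⟨c, hc⟩ := Ideal.mem_span_singleton.1 hn
  have hc0 : c ≠ 0 := by
    rintro rfl
    simp at hc
  exact ⟨n, ⟨c, mem_nonZeroDivisors_of_ne_zero hc0⟩, Subtype.ext (by simpa using hc)⟩

/-- The value function of a local Cohen-Kaplansky domain, with the exponent `m` and the conductor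
bound `N`. -/
structure IsValueHom (V : R⁰ → ℕ) (N m : ℕ) : Prop where
  pos : 0 < m
  map_mul : ∀ x y, V (x * y) = V x + V y
  eq_zero_iff : ∀ x, V x = 0 ↔ IsUnit x
  dvd_of_add_le : ∀ x y, V y + N ≤ V x → y ∣ x
  pow_dvd_pow : ∀ x y, V y ≤ V x → y ^ m ∣ x ^ m

theorem isCancelMul_associates (H : Type u) [CommMonoid H] [IsCancelMul H] :
    IsCancelMul (Associates H) := by
  refine @CommMagma.IsLeftCancelMul.toIsCancelMul _ _ ⟨fun a b c h => ?_⟩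
  obtain ⟨a, rfl⟩ := Associates.mk_surjective a
  obtain ⟨b, rfl⟩ := Associates.mk_surjective b
  obtain ⟨c, rfl⟩ := Associates.mk_surjective c
  simp only [Associates.mk_mul_mk, Associates.mk_eq_mk_iff_associated] at h ⊢
  obtain ⟨ε, hε⟩ := h
  exact ⟨ε, mul_left_cancel (a := a) (by rw [← hε, mul_assoc])⟩

/-- The monoid of associate classes is reduced, cancellative, primary and generated by the finitely
many classes of atoms; its value function is pulled back to `R⁰`. -/
theorem IsCohenKaplansky.exists_isValueHom (hR : IsCohenKaplansky R) :
    ∃ (V : R⁰ → ℕ) (N m : ℕ), IsValueHom V N m := by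
  have := isCancelMul_nonZeroDivisors (R := R)
  have := isCancelMul_associates R⁰
  have hgen : Submonoid.closure
      {x : Associates R⁰ | ∃ p : R⁰, Irreducible p ∧ Associates.mk p = x} = ⊤ := by
    refine eq_top_iff.2 fun x _ => ?_
    obtain ⟨x, rfl⟩ := Associates.mk_surjective x
    by_cases hx : IsUnit x
    · rw [Associates.mk_eq_one.2 hx]
      exact one_mem _
    · obtain ⟨s, hs, rfl⟩ := hR.1 x hx
      rw [← Associates.prod_mk]
      refine multiset_prod_mem _ fun y hy => ?_
      obtain ⟨p, hp, rfl⟩ := Multiset.mem_map.1 hy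
      exact Submonoid.subset_closure ⟨p, hs p hp, rfl⟩
  obtain ⟨V, N, m, hm, hmul, h0, hN, hpow⟩ := exists_value_hom_of_fg_primary
    (D := Associates R⁰) (fun x hx => (Associates.isUnit_iff_eq_one x).1 hx) hR.2 hgen
    (by
      rintro ⟨p, hp, hp1⟩
      exact hp.not_isUnit (Associates.mk_eq_one.1 hp1))
    (by
      rintro _ ⟨p, hp, rfl⟩ _ ⟨q, hq, rfl⟩
      obtain ⟨n, hn⟩ := hR.exists_dvd_pow p q hq.not_isUnit
      exact ⟨n, by rw [← Associates.mk_pow]; exact Associates.mk_dvd_mk.2 hn⟩)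
  refine ⟨fun x => V (Associates.mk x), N, m, hm, fun x y => ?_, fun x => ?_, fun x y h => ?_,
    fun x y h => ?_⟩
  · rw [← Associates.mk_mul_mk, hmul]
  · rw [h0, Associates.mk_eq_one]
  · exact Associates.mk_dvd_mk.1 (hN _ _ h)
  · rw [← Associates.mk_dvd_mk, Associates.mk_pow, Associates.mk_pow]
    exact hpow _ _ h

end LocalDomain

/-! ### Domains with a value function all of whose atoms have the same value -/

section ValueHom

theorem IsAtomicMonoid.exists_associated_prod {H : Type u} [CommMonoid H] (hH : IsAtomicMonoid H)
    (x : H) : ∃ s : Multiset H, (∀ p ∈ s, Irreducible p) ∧ Associated s.prod x := by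
  by_cases hx : IsUnit x
  · exact ⟨0, by simp, by simpa using (associated_one_iff_isUnit.2 hx).symm⟩
  · obtain ⟨s, hs, rfl⟩ := hH x hx
    exact ⟨s, hs, Associated.refl _⟩

variable {R : Type u} [CommRing R] {V : R⁰ → ℕ} {N m e : ℕ}

namespace IsValueHom

theorem map_one (hV : IsValueHom V N m) : V 1 = 0 := (hV.eq_zero_iff 1).2 isUnit_one

theorem map_pow (hV : IsValueHom V N m) (x : R⁰) (n : ℕ) : V (x ^ n) = n * V x := by
  induction n with
  | zero => simp [hV.map_one]
  | succ n ih => rw [pow_succ, hV.map_mul, ih, Nat.succ_mul]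

theorem map_eq_of_associated (hV : IsValueHom V N m) {x y : R⁰} (h : Associated x y) :
    V x = V y := by
  obtain ⟨ε, rfl⟩ := h
  rw [hV.map_mul, (hV.eq_zero_iff _).2 ε.isUnit, add_zero]

theorem map_pos (hV : IsValueHom V N m) {x : R⁰} (hx : ¬ IsUnit x) : 0 < V x :=
  Nat.pos_of_ne_zero fun h => hx ((hV.eq_zero_iff x).1 h)

theorem map_multiset_prod (hV : IsValueHom V N m) (he : ∀ u : R⁰, Irreducible u → V u = e)
    (s : Multiset R⁰) (hs : ∀ p ∈ s, Irreducible p) : V s.prod = Multiset.card s * e := by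
  induction s using Multiset.induction_on with
  | empty => simp [hV.map_one]
  | cons p s ih =>
    rw [Multiset.prod_cons, hV.map_mul, he p (hs p (Multiset.mem_cons_self p s)),
      ih fun q hq => hs q (Multiset.mem_cons_of_mem hq), Multiset.card_cons, Nat.succ_mul, add_comm]

theorem card_le_map_prod (hV : IsValueHom V N m) (s : Multiset R⁰)
    (hs : ∀ p ∈ s, Irreducible p) : Multiset.card s ≤ V s.prod := by
  induction s using Multiset.induction_on with
  | empty => simp
  | cons p s ih =>
    have h1 := ih fun q hq => hs q (Multiset.mem_cons_of_mem hq)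
    have h2 := hV.map_pos (hs p (Multiset.mem_cons_self p s)).not_isUnit
    rw [Multiset.prod_cons, hV.map_mul, Multiset.card_cons]
    omega

/-- If all atoms have the same value, then each element has divisors of all possible values. -/
theorem exists_eq_mul (hV : IsValueHom V N m) (hat : IsAtomicMonoid R⁰)
    (he : ∀ u : R⁰, Irreducible u → V u = e) {x y : R⁰} (h : V y ≤ V x) :
    ∃ a b : R⁰, x = a * b ∧ V a = V y := by
  obtain ⟨s, hs, hsx⟩ := hat.exists_associated_prod x
  obtain ⟨t, ht, hty⟩ := hat.exists_associated_prod y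
  have hx := hV.map_eq_of_associated hsx
  have hy := hV.map_eq_of_associated hty
  rw [hV.map_multiset_prod he s hs] at hx
  rw [hV.map_multiset_prod he t ht] at hy
  rcases le_total (Multiset.card t) (Multiset.card s) with hts | hst
  · obtain ⟨r, hr⟩ : ∃ r, r ∈ Multiset.powersetCard (Multiset.card t) s := by
      rw [← Multiset.card_pos_iff_exists_mem, Multiset.card_powersetCard]
      exact Nat.choose_pos hts
    rw [Multiset.mem_powersetCard] at hr
    obtain ⟨q, rfl⟩ := Multiset.le_iff_exists_add.1 hr.1
    obtain ⟨ε, rfl⟩ := hsx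
    refine ⟨r.prod, q.prod * ε, by rw [Multiset.prod_add, mul_assoc], ?_⟩
    rw [hV.map_multiset_prod he r fun p hp => hs p (Multiset.mem_add.2 (Or.inl hp)), hr.2, hy]
  -- Here `x` has no more atoms than `y`, so the two values agree and `x` itself serves.
  · refine ⟨x, 1, (mul_one x).symm, le_antisymm ?_ h⟩
    rw [← hx, ← hy]
    exact Nat.mul_le_mul_right e hst

/-- If all atoms have the same value, then the monoid is half-factorial. -/
theorem isHalfFactorial (hV : IsValueHom V N m) (hat : IsAtomicMonoid R⁰)
    (he : ∀ u : R⁰, Irreducible u → V u = e) : IsHalfFactorial R⁰ := by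
  refine ⟨hat, fun a => Set.ncard_eq_one.2 ?_⟩
  by_cases ha : IsUnit a
  · exact ⟨0, by ext k; simp [lengths, ha]⟩
  obtain ⟨s, hs, hsa⟩ := hat a ha
  have hVs := hV.map_multiset_prod he s hs
  have hpos := hV.map_pos ha
  rw [hsa] at hVs
  refine ⟨Multiset.card s, Set.eq_singleton_iff_unique_mem.2
    ⟨Or.inr ⟨ha, s, rfl, hs, hsa⟩, ?_⟩⟩
  rintro k (⟨h, -⟩ | ⟨-, t, rfl, ht, hta⟩)
  · exact absurd h ha
  · have hVt := hV.map_multiset_prod he t ht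
    rw [hta, hVs] at hVt
    refine (Nat.eq_of_mul_eq_mul_right (Nat.pos_of_ne_zero ?_) hVt).symm
    rintro rfl
    omega

end IsValueHom

theorem IsHalfFactorial.card_eq {H : Type u} [CommMonoid H] (hH : IsHalfFactorial H)
    {s t : Multiset H} (hs : ∀ p ∈ s, Irreducible p) (ht : ∀ p ∈ t, Irreducible p)
    (h : s.prod = t.prod) (hu : ¬ IsUnit s.prod) : Multiset.card s = Multiset.card t := by
  obtain ⟨k, hk⟩ := Set.ncard_eq_one.1 (hH.2 s.prod)
  have h1 : Multiset.card s ∈ lengths s.prod := Or.inr ⟨hu, s, rfl, hs, rfl⟩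
  have h2 : Multiset.card t ∈ lengths s.prod := Or.inr ⟨hu, t, rfl, ht, h.symm⟩
  rw [hk] at h1 h2
  exact h1.trans h2.symm

namespace IsValueHom

/-- If `V p < V q`, a power of `p` equals a power of `q` times a cofactor `y`. The number of powers
of `p` exceeds that of `q` by an amount growing with `j`, while `V y`, which bounds the length of
`y`, does not depend on `j`. Half-factoriality fails once `j` exceeds `V y`. -/
theorem map_le_of_isHalfFactorial (hV : IsValueHom V N m) (hH : IsHalfFactorial R⁰) {p q : R⁰}
    (hp : Irreducible p) (hq : Irreducible q) : V q ≤ V p := by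
  by_contra! hlt
  have hp0 := hV.map_pos hp.not_isUnit
  have hq0 := hV.map_pos hq.not_isUnit
  set j := V p * V q * (N + 1) + 1 with hj
  -- The values differ by `V p * V q * (N + 1)`: at least `N`, so that divisibility holds, and
  -- positive, so that the cofactor is a non-unit.
  have hdvd : q ^ (V p * j) ∣ p ^ (V q * (N + 1 + j)) := by
    apply hV.dvd_of_add_le
    rw [hV.map_pow, hV.map_pow]
    have : N + 1 ≤ V q * V p * (N + 1) := Nat.le_mul_of_pos_left _ (Nat.mul_pos hq0 hp0)
    nlinarith
  obtain ⟨y, hy⟩ := hdvd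
  have hVy : V y = V p * V q * (N + 1) := by
    have := congrArg V hy
    rw [hV.map_mul, hV.map_pow, hV.map_pow] at this
    nlinarith
  have hyu : ¬ IsUnit y := by
    rw [← hV.eq_zero_iff, hVy]
    positivity
  obtain ⟨s, hs, rfl⟩ := hH.1 y hyu
  have hcard := hH.card_eq (s := Multiset.replicate (V q * (N + 1 + j)) p)
    (t := Multiset.replicate (V p * j) q + s)
    (fun x hx => Multiset.eq_of_mem_replicate hx ▸ hp)
    (fun x hx => (Multiset.mem_add.1 hx).elim
      (fun h => Multiset.eq_of_mem_replicate h ▸ hq) (hs x))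
    (by rw [Multiset.prod_add, Multiset.prod_replicate, Multiset.prod_replicate, hy])
    (by
      rw [Multiset.prod_replicate, hy]
      exact fun h => hyu (isUnit_of_mul_isUnit_right h))
  rw [Multiset.card_add, Multiset.card_replicate, Multiset.card_replicate] at hcard
  have hle := hV.card_le_map_prod s hs
  rw [hVy] at hle
  have h1 : (V p + 1) * j ≤ V q * j := Nat.mul_le_mul_right j hlt
  nlinarith [Nat.zero_le (V q * (N + 1))]

theorem exists_atom_value_of_le (h : ∀ p q : R⁰, Irreducible p → Irreducible q → V q ≤ V p) :
    ∃ e, ∀ u : R⁰, Irreducible u → V u = e := by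
  by_cases hex : ∃ p : R⁰, Irreducible p
  · obtain ⟨p, hp⟩ := hex
    exact ⟨V p, fun u hu => le_antisymm (h p u hp hu) (h u p hu hp)⟩
  · exact ⟨0, fun u hu => absurd ⟨u, hu⟩ hex⟩

end IsValueHom

end ValueHom

/-! ### Transfer homomorphisms to completely integrally closed monoids -/

section Transfer

theorem of_div_of_mem_mrange_iff {B : Type v} [CancelCommMonoid B] {x y : B} :
    Algebra.GrothendieckGroup.of x / Algebra.GrothendieckGroup.of y ∈
      MonoidHom.mrange (Algebra.GrothendieckGroup.of (M := B)) ↔ y ∣ x := by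
  constructor
  · rintro ⟨z, hz⟩
    refine ⟨z, Algebra.GrothendieckGroup.of_injective ?_⟩
    rw [map_mul, hz, mul_div_cancel]
  · rintro ⟨z, rfl⟩
    exact ⟨z, by rw [map_mul, mul_div_cancel_left]⟩

/-- A divisibility criterion in completely integrally closed monoids. -/
theorem dvd_of_forall_pow_dvd {B : Type v} [CancelCommMonoid B] (hB : IsKrullMonoid B)
    {x y c : B} (h : ∀ n : ℕ, y ^ n ∣ x ^ n * c) : y ∣ x := by
  rw [← of_div_of_mem_mrange_iff, ← SetLike.mem_coe, ← hB.1]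
  refine ⟨Algebra.GrothendieckGroup.of c, ⟨c, rfl⟩, fun n _ => ?_⟩
  rw [div_pow, ← map_pow, ← map_pow, ← mul_div_assoc, ← map_mul, mul_comm c]
  exact of_div_of_mem_mrange_iff.2 (h n)

theorem IsTransferHom.irreducible {H : Type u} {B : Type v} [CommMonoid H] [CommMonoid B]
    {θ : H →* B} (hθ : IsTransferHom θ) {p : H} (hp : Irreducible p) : Irreducible (θ p) := by
  refine ⟨fun h => hp.not_isUnit ((hθ.isUnit_iff p).1 h), fun b c hbc => ?_⟩
  obtain ⟨v, w, ε, η, hvw, hv, hw⟩ := hθ.exists_lift p b c hbc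
  refine (hp.isUnit_or_isUnit hvw).imp (fun h => ?_) fun h => ?_
  · have := (hθ.isUnit_iff v).2 h
    rw [hv] at this
    exact isUnit_of_mul_isUnit_left this
  · have := (hθ.isUnit_iff w).2 h
    rw [hw] at this
    exact isUnit_of_mul_isUnit_left this

variable {R : Type u} [CommRing R] {V : R⁰ → ℕ} {N m e : ℕ}

/-- For a non-unit `y`, the factor `y ^ N` has value at least `N` and pays for the error term, so `y
^ n ∣ x ^ n * y ^ N` for all `n`. The quotient of the images is thus almost integral, and a Krull
monoid contains it. -/
theorem IsValueHom.map_dvd_map (hV : IsValueHom V N m) {B : Type v} [CancelCommMonoid B]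
    (hB : IsKrullMonoid B) (θ : R⁰ →* B) {x y : R⁰} (h : V y ≤ V x) : θ y ∣ θ x := by
  by_cases hy : IsUnit y
  · exact (hy.map θ).dvd
  refine dvd_of_forall_pow_dvd hB (c := θ (y ^ N)) fun n => ?_
  rw [← _root_.map_pow, ← _root_.map_pow, ← _root_.map_mul]
  refine map_dvd θ (hV.dvd_of_add_le _ _ ?_)
  rw [hV.map_mul, hV.map_pow, hV.map_pow, hV.map_pow]
  exact add_le_add (Nat.mul_le_mul_left n h) (Nat.le_mul_of_pos_right N (hV.map_pos hy))

/-- If `V p < V q`, then `θ p` divides `θ q`, and both are atoms, so they are associated. Comparing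
values, `θ p ^ (V p + 1)` divides `θ q ^ V p`, which is associated to `θ p ^ V p`; this forces `θ p`
to be a unit. -/
theorem IsValueHom.map_le_of_isTransferKrull (hV : IsValueHom V N m)
    (hR : IsTransferKrull.{u, v} R⁰) {p q : R⁰} (hp : Irreducible p) (hq : Irreducible q) :
    V q ≤ V p := by
  obtain ⟨B, _, hB, θ, hθ⟩ := hR
  by_contra! hlt
  have hass : Associated (θ p) (θ q) :=
    ((hθ.irreducible hp).dvd_irreducible_iff_associated (hθ.irreducible hq)).1
      (hV.map_dvd_map hB θ hlt.le)
  have hdvd : θ (p ^ (V p + 1)) ∣ θ (q ^ V p) := by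
    apply hV.map_dvd_map hB
    rw [hV.map_pow, hV.map_pow]
    nlinarith
  have hdvd' : θ p ^ V p * θ p ∣ θ p ^ V p * 1 := by
    rw [_root_.map_pow, _root_.map_pow, pow_succ] at hdvd
    rw [mul_one]
    exact hdvd.trans (hass.symm.pow_pow).dvd
  obtain ⟨c, hc⟩ := hdvd'
  rw [mul_assoc] at hc
  exact (hθ.irreducible hp).not_isUnit (IsUnit.of_mul_eq_one c (mul_left_cancel hc).symm)

/-- A cancellative monoid in which divisibility is controlled by a natural number value is Krull. -/
theorem isKrullMonoid_of_value {B : Type v} [CancelCommMonoid B] (f : B → ℕ)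
    (hmul : ∀ x y, f (x * y) = f x + f y) (hdvd : ∀ x y, f y ≤ f x → y ∣ x) :
    IsKrullMonoid B := by
  have hone : f 1 = 0 := by have := hmul 1 1; rw [mul_one] at this; omega
  have hpow : ∀ (x : B) (n : ℕ), f (x ^ n) = n * f x := by
    intro x n
    induction n with
    | zero => simp [hone]
    | succ n ih => rw [pow_succ, hmul, ih, Nat.succ_mul]
  refine ⟨Set.Subset.antisymm ?_ ?_, ?_⟩
  · rintro x ⟨_, ⟨c, rfl⟩, hx⟩
    obtain ⟨y, z, rfl⟩ : ∃ y z : B,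
        x = Algebra.GrothendieckGroup.of y / Algebra.GrothendieckGroup.of z := by
      obtain ⟨⟨y, z⟩, hyz⟩ := (Localization.monoidOf (⊤ : Submonoid B)).surj x
      exact ⟨y, z, eq_div_of_mul_eq' hyz⟩
    refine of_div_of_mem_mrange_iff.2 (hdvd _ _ ?_)
    -- If `f y < f z`, the denominators `z ^ n` outgrow the fixed `c`; the exponent `f c + 1`
    -- already suffices.
    by_contra! hlt
    have h := hx (f c + 1) (Nat.succ_pos _)
    rw [div_pow, ← map_pow, ← map_pow, ← mul_div_assoc, ← map_mul, of_div_of_mem_mrange_iff] at h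
    obtain ⟨d, hd⟩ := h
    have hd' := congrArg f hd
    rw [hmul, hmul, hpow, hpow] at hd'
    nlinarith
  · rintro _ ⟨x, rfl⟩
    exact ⟨1, one_mem _, fun n _ => by
      rw [one_mul]
      exact pow_mem (MonoidHom.mem_mrange.2 ⟨x, rfl⟩) n⟩
  · intro F hF hideal
    have hup : ∀ n (x y : B), Algebra.GrothendieckGroup.of x ∈ F n → x ∣ y →
        Algebra.GrothendieckGroup.of y ∈ F n := by
      rintro n x _ hx ⟨z, rfl⟩
      rw [← (hideal n).2]
      refine ⟨{Algebra.GrothendieckGroup.of x}, Set.finite_singleton _,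
        Set.singleton_subset_iff.2 hx, fun a ha => ?_⟩
      rw [map_mul, mul_right_comm, mul_comm _ a]
      exact mul_mem (ha _ rfl) (MonoidHom.mem_mrange.2 ⟨z, rfl⟩)
    -- An element of least value in the whole chain divides all others, so the chain is constant
    -- from the ideal where it appears.
    by_cases hex : ∃ k, ∃ (n : ℕ) (x : B), Algebra.GrothendieckGroup.of x ∈ F n ∧ f x = k
    · classical
      obtain ⟨n, x, hx, hk⟩ := Nat.find_spec hex
      refine ⟨n, fun l hl => Set.Subset.antisymm (fun y hy => ?_) (hF hl)⟩
      obtain ⟨y, rfl⟩ := (hideal l).1 hy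
      exact hup n x y hx (hdvd _ _ (hk ▸ Nat.find_min' hex ⟨l, y, hy, rfl⟩))
    · have hempty : ∀ n, F n = ∅ := fun n => Set.eq_empty_of_forall_notMem fun y hy => by
        obtain ⟨x, rfl⟩ := (hideal n).1 hy
        exact hex ⟨_, n, x, hy, rfl⟩
      exact ⟨0, fun n _ => by rw [hempty, hempty]⟩

/-- If all atoms have the same value, then the value function is a transfer homomorphism onto a
monoid of natural numbers, which is Krull. -/
theorem IsValueHom.isTransferKrull (hV : IsValueHom V N m) (hat : IsAtomicMonoid R⁰)
    (he : ∀ u : R⁰, Irreducible u → V u = e) : IsTransferKrull.{u, v} R⁰ := by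
  let ν : R⁰ →* Multiplicative ℕ :=
    { toFun := fun x => Multiplicative.ofAdd (V x)
      map_one' := by rw [hV.map_one]; rfl
      map_mul' := fun x y => by rw [hV.map_mul]; rfl }
  -- The target is the image of `V`, not all of `ℕ`, so that `θ` is onto; `ULift` moves it to the
  -- prescribed universe.
  let θ : R⁰ →* ULift.{v} (MonoidHom.mrange ν) :=
    MulEquiv.ulift.symm.toMonoidHom.comp ν.mrangeRestrict
  let f : ULift.{v} (MonoidHom.mrange ν) → ℕ :=
    fun b => Multiplicative.toAdd (b.down : Multiplicative ℕ)
  have hinj : Function.Injective f := fun a b h =>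
    ULift.down_injective (Subtype.ext (Multiplicative.toAdd.injective h))
  have hsurj : Function.Surjective θ := by
    rintro ⟨_, x, rfl⟩
    exact ⟨x, rfl⟩
  have hfθ : ∀ x, f (θ x) = V x := fun x => rfl
  have hmul : ∀ x y, f (x * y) = f x + f y := fun x y => rfl
  let inst : CancelCommMonoid (ULift.{v} (MonoidHom.mrange ν)) :=
    { (inferInstance : CommMonoid (ULift.{v} (MonoidHom.mrange ν))) with
      mul_left_cancel := fun a b c h => hinj (by
        have := congrArg f h
        rw [hmul, hmul] at this
        exact Nat.add_left_cancel this) }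
  refine ⟨ULift.{v} (MonoidHom.mrange ν), inst,
    isKrullMonoid_of_value f hmul fun x y h => ?_, θ, ?_, ?_, ?_⟩
  · obtain ⟨x, rfl⟩ := hsurj x
    obtain ⟨y, rfl⟩ := hsurj y
    obtain ⟨a, b, hab, ha⟩ := hV.exists_eq_mul hat he h
    have hay : θ a = θ y := hinj ha
    exact ⟨θ b, by rw [hab, _root_.map_mul, hay]⟩
  · intro b
    obtain ⟨x, rfl⟩ := hsurj b
    exact ⟨x, 1, by simp⟩
  · refine fun x => ⟨fun h => ?_, fun h => h.map θ⟩
    obtain ⟨c, hc⟩ := h.exists_right_inv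
    have h0 := congrArg f hc
    rw [hmul, hfθ] at h0
    have h1 : f 1 = 0 := rfl
    exact (hV.eq_zero_iff x).1 (by omega)
  · intro x b c hbc
    obtain ⟨y, rfl⟩ := hsurj b
    obtain ⟨z, rfl⟩ := hsurj c
    have hval : V x = V y + V z := congrArg f hbc
    obtain ⟨a, b, hab, ha⟩ := hV.exists_eq_mul hat he (y := y) (x := x) (by omega)
    have hb : V b = V z := by
      rw [hab, hV.map_mul] at hval
      omega
    refine ⟨a, b, 1, 1, hab, ?_, ?_⟩
    · rw [Units.val_one, mul_one]; exact hinj ha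
    · rw [Units.val_one, mul_one]; exact hinj hb

end Transfer

/-! ### The integral closure -/

section IntegralClosure

variable {R : Type u} [CommRing R] [IsDomain R] {K : Type w} [Field K] [Algebra R K]
  [IsFractionRing R K] {V : R⁰ → ℕ} {N m e : ℕ}

theorem algebraMap_ne_zero (x : R⁰) : algebraMap R K x ≠ 0 :=
  IsFractionRing.to_map_ne_zero_of_mem_nonZeroDivisors x.2

/-- An integral extension creates no new units among elements of `R`. -/
theorem isUnit_nonzeroInclusion_iff (x : R⁰) :
    IsUnit (nonzeroInclusion R (integralClosure R K) x) ↔ IsUnit x := by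
  rw [← isUnit_coe_nonZeroDivisors_iff, ← isUnit_coe_nonZeroDivisors_iff]
  exact isUnit_map_iff (algebraMap R (integralClosure R K)) _

theorem nonzeroInclusion_mul_cancel {x : R⁰} {b c : (integralClosure R K)⁰}
    (h : nonzeroInclusion R (integralClosure R K) x * b =
      nonzeroInclusion R (integralClosure R K) x * c) : b = c :=
  Subtype.ext (mul_left_cancel₀
    (nonZeroDivisors.coe_ne_zero (nonzeroInclusion R (integralClosure R K) x))
    (congrArg Subtype.val h))

theorem exists_nonzeroInclusion_mul_eq (z : (integralClosure R K)⁰) :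
    ∃ x y : R⁰, nonzeroInclusion R (integralClosure R K) y * z =
      nonzeroInclusion R (integralClosure R K) x := by
  obtain ⟨x, y, hy, hxy⟩ := IsFractionRing.div_surjective R (z : K)
  have hy0 := algebraMap_ne_zero (K := K) ⟨y, hy⟩
  have hz0 : ((z : integralClosure R K) : K) ≠ 0 := by simp
  have hx0 : x ≠ 0 := by
    rintro rfl
    rw [map_zero, zero_div] at hxy
    exact hz0 hxy.symm
  refine ⟨⟨x, mem_nonZeroDivisors_of_ne_zero hx0⟩, ⟨y, hy⟩, Subtype.ext (Subtype.ext ?_)⟩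
  change algebraMap R K y * ((z : integralClosure R K) : K) = algebraMap R K x
  rw [← hxy, mul_div_cancel₀ _ hy0]

namespace IsValueHom

/-- If `V y ≤ V x`, then `(x / y) ^ m` lies in `R`, so `x / y` is integral. Conversely, if `x = y *
z` with `V x < V y`, then `y ^ m = x ^ m * r` gives `z ^ m * r = 1`; so `r` is a unit of `R` and the
values coincide. -/
theorem nonzeroInclusion_dvd_iff (hV : IsValueHom V N m) {x y : R⁰} :
    nonzeroInclusion R (integralClosure R K) y ∣
      nonzeroInclusion R (integralClosure R K) x ↔ V y ≤ V x := by
  constructor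
  · rintro ⟨z, hz⟩
    by_contra! hlt
    obtain ⟨r, hr⟩ := hV.pow_dvd_pow y x hlt.le
    have hone : z ^ m * nonzeroInclusion R (integralClosure R K) r = 1 := by
      apply nonzeroInclusion_mul_cancel (x := y ^ m)
      rw [mul_one, ← mul_assoc, _root_.map_pow, ← mul_pow, ← hz, ← _root_.map_pow, ← _root_.map_mul,
        ← hr, _root_.map_pow]
    have hr0 := (hV.eq_zero_iff r).2
      ((isUnit_nonzeroInclusion_iff (K := K) r).1 (IsUnit.of_mul_eq_one_right _ hone))
    have := congrArg V hr
    rw [hV.map_mul, hV.map_pow, hV.map_pow, hr0, add_zero] at this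
    exact hlt.ne' (Nat.eq_of_mul_eq_mul_left hV.pos this)
  · intro h
    obtain ⟨r, hr⟩ := hV.pow_dvd_pow x y h
    have hx0 := algebraMap_ne_zero (K := K) x
    have hy0 := algebraMap_ne_zero (K := K) y
    have hint : IsIntegral R (algebraMap R K x / algebraMap R K y) := by
      refine IsIntegral.of_pow hV.pos ?_
      have hr' : algebraMap R K x ^ m = algebraMap R K y ^ m * algebraMap R K r := by
        rw [← _root_.map_pow, ← _root_.map_pow, ← _root_.map_mul]
        exact congrArg (fun a : R⁰ => algebraMap R K a) hr
      rw [div_pow, hr', mul_div_cancel_left₀ _ (pow_ne_zero m hy0)]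
      exact isIntegral_algebraMap
    have hne : (⟨_, hint⟩ : integralClosure R K) ≠ 0 :=
      fun h0 => div_ne_zero hx0 hy0 (congrArg Subtype.val h0)
    refine ⟨⟨⟨_, hint⟩, mem_nonZeroDivisors_of_ne_zero hne⟩, Subtype.ext (Subtype.ext ?_)⟩
    change algebraMap R K x = algebraMap R K y * (algebraMap R K x / algebraMap R K y)
    rw [mul_div_cancel₀ _ hy0]

theorem associated_nonzeroInclusion_iff (hV : IsValueHom V N m) {x y : R⁰} :
    Associated (nonzeroInclusion R (integralClosure R K) x)
      (nonzeroInclusion R (integralClosure R K) y) ↔ V x = V y := by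
  refine ⟨fun h => le_antisymm (hV.nonzeroInclusion_dvd_iff.1 h.dvd)
    (hV.nonzeroInclusion_dvd_iff.1 h.symm.dvd), fun h => ?_⟩
  have := isCancelMul_nonZeroDivisors (R := integralClosure R K)
  obtain ⟨c, hc⟩ := hV.nonzeroInclusion_dvd_iff (K := K).2 h.le
  obtain ⟨d, hd⟩ := hV.nonzeroInclusion_dvd_iff (K := K).2 h.ge
  have hcd : c * d = 1 := by
    apply nonzeroInclusion_mul_cancel (x := x)
    rw [← mul_assoc, ← hc, ← hd, mul_one]
  exact ⟨Units.mkOfMulEqOne c d hcd, hc.symm⟩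

/-- If all atoms have the same value, then each element of the integral closure is associated to an
element of the domain. -/
theorem exists_associated_nonzeroInclusion (hV : IsValueHom V N m) (hat : IsAtomicMonoid R⁰)
    (he : ∀ u : R⁰, Irreducible u → V u = e) (z : (integralClosure R K)⁰) :
    ∃ h : R⁰, Associated (nonzeroInclusion R (integralClosure R K) h) z := by
  obtain ⟨x, y, hxy⟩ := exists_nonzeroInclusion_mul_eq z
  -- With `z = x / y`, split off from `x` a divisor `a` of the same value as `y`. It is associated
  -- to `y` in the integral closure, so the cofactor `b` is associated to `z`.
  obtain ⟨a, b, hab, ha⟩ := hV.exists_eq_mul hat he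
    (hV.nonzeroInclusion_dvd_iff.1 (Dvd.intro z hxy))
  obtain ⟨ε, hε⟩ := (hV.associated_nonzeroInclusion_iff (K := K)).2 ha
  refine ⟨b, Associated.symm ⟨ε, nonzeroInclusion_mul_cancel (x := a) ?_⟩⟩
  rw [← _root_.map_mul, ← hab, ← hxy, ← hε, mul_assoc, mul_comm z]

theorem isTransferHom_nonzeroInclusion (hV : IsValueHom V N m) (hat : IsAtomicMonoid R⁰)
    (he : ∀ u : R⁰, Irreducible u → V u = e) :
    IsTransferHom (nonzeroInclusion R (integralClosure R K)) := by
  refine ⟨fun b => ?_, isUnit_nonzeroInclusion_iff, fun x b c hbc => ?_⟩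
  · obtain ⟨h, ε, hε⟩ := hV.exists_associated_nonzeroInclusion hat he b
    exact ⟨h, ε, hε.symm⟩
  · obtain ⟨y, hy⟩ := hV.exists_associated_nonzeroInclusion hat he b
    obtain ⟨z, hz⟩ := hV.exists_associated_nonzeroInclusion hat he c
    have hval : V x = V y + V z := by
      rw [← hV.map_mul, ← hV.associated_nonzeroInclusion_iff (K := K), _root_.map_mul, hbc]
      exact (hy.mul_mul hz).symm
    obtain ⟨v, w, hvw, hv⟩ := hV.exists_eq_mul hat he (y := y) (x := x) (by omega)
    have hw : V w = V z := by
      rw [hvw, hV.map_mul] at hval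
      omega
    obtain ⟨ε, hε⟩ := (hy.symm.trans (hV.associated_nonzeroInclusion_iff.2 hv.symm))
    obtain ⟨η, hη⟩ := (hz.symm.trans (hV.associated_nonzeroInclusion_iff.2 hw.symm))
    exact ⟨v, w, ε, η, hvw, hε.symm, hη.symm⟩

/-- Atoms stay atoms in the integral closure, and there the one of smaller value divides the other,
so they are associated and have equal values. -/
theorem map_le_of_isTransferHom (hV : IsValueHom V N m)
    (hR : IsTransferHom (nonzeroInclusion R (integralClosure R K))) {p q : R⁰} (hp : Irreducible p)
    (hq : Irreducible q) : V q ≤ V p := by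
  by_contra! hlt
  have hass := ((hR.irreducible hp).dvd_irreducible_iff_associated (hR.irreducible hq)).1
    (hV.nonzeroInclusion_dvd_iff.2 hlt.le)
  exact hlt.ne (hV.associated_nonzeroInclusion_iff.1 hass)

end IsValueHom

variable [IsLocalRing R]

/-- By lying over, some maximal ideal of the integral closure contracts to the maximal ideal of `R`,
and it contains the extended ideal. -/
theorem not_isUnit_of_mem_map_maximalIdeal {x : integralClosure R K}
    (hx : x ∈ (IsLocalRing.maximalIdeal R).map (algebraMap R (integralClosure R K))) :
    ¬ IsUnit x := by
  obtain ⟨Q, hQ, hQM⟩ := Ideal.exists_ideal_over_maximal_of_isIntegral (S := integralClosure R K)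
    (IsLocalRing.maximalIdeal R) (by
      rw [(RingHom.injective_iff_ker_eq_bot _).1
        (FaithfulSMul.algebraMap_injective R (integralClosure R K))]
      exact bot_le)
  exact fun h => hQ.ne_top
    (Ideal.eq_top_of_isUnit_mem _ (Ideal.map_le_iff_le_comap.2 hQM.ge hx) h)

theorem IsValueHom.exists_eq_algebraMap_mul (hV : IsValueHom V N m) (hat : IsAtomicMonoid R⁰)
    (he : ∀ u : R⁰, Irreducible u → V u = e) {x : integralClosure R K} (hx : ¬ IsUnit x) :
    ∃ a ∈ IsLocalRing.maximalIdeal R, ∃ y : integralClosure R K,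
      x = algebraMap R (integralClosure R K) a * y := by
  by_cases hx0 : x = 0
  · exact ⟨0, zero_mem _, 0, by simp [hx0]⟩
  obtain ⟨h, ε, hε⟩ := hV.exists_associated_nonzeroInclusion hat he
    ⟨x, mem_nonZeroDivisors_of_ne_zero hx0⟩
  refine ⟨h, ?_, ((ε : (integralClosure R K)⁰) : integralClosure R K),
    (congrArg Subtype.val hε).symm⟩
  rw [IsLocalRing.mem_maximalIdeal, mem_nonunits_iff, isUnit_coe_nonZeroDivisors_iff,
    ← isUnit_nonzeroInclusion_iff (K := K)]
  intro hu
  have := isUnit_coe_nonZeroDivisors_iff.2 (hε ▸ hu.mul ε.isUnit)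
  exact hx this

end IntegralClosure

end CK

/-! ### The equivalence and the extension of the maximal ideal -/

theorem mainTheorem10 (R : Type u) [CommRing R] [IsDomain R] [IsLocalRing R]
    (K : Type w) [Field K] [Algebra R K] [IsFractionRing R K]
    (hR : CK.IsCohenKaplansky R) :
    List.TFAE
      [CK.IsHalfFactorial R⁰,
       CK.IsTransferKrull.{u, v} R⁰,
       CK.IsTransferHom (CK.nonzeroInclusion R (integralClosure R K))] ∧
    (CK.IsHalfFactorial R⁰ →
      (((IsLocalRing.maximalIdeal R).map (algebraMap R (integralClosure R K)) :
          Ideal (integralClosure R K)) : Set (integralClosure R K)) =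
        {x | ¬ IsUnit x} ∧
      {x : integralClosure R K | ∃ m ∈ IsLocalRing.maximalIdeal R, ∃ y : integralClosure R K,
          x = algebraMap R (integralClosure R K) m * y} =
        {x | ¬ IsUnit x}) := by
  obtain ⟨V, N, m, hV⟩ := hR.exists_isValueHom
  have hhf : CK.IsHalfFactorial R⁰ → ∃ e, ∀ u : R⁰, Irreducible u → V u = e := fun h =>
    CK.IsValueHom.exists_atom_value_of_le fun _ _ => hV.map_le_of_isHalfFactorial h
  have hmul_mem : ∀ a ∈ IsLocalRing.maximalIdeal R, ∀ y : integralClosure R K,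
      algebraMap R (integralClosure R K) a * y ∈
        (IsLocalRing.maximalIdeal R).map (algebraMap R (integralClosure R K)) := fun a ha y =>
    Ideal.mul_mem_right _ _ (Ideal.mem_map_of_mem _ ha)
  refine ⟨?_, fun h => ?_⟩
  · tfae_have 1 → 2 := fun h => by
      obtain ⟨e, he⟩ := hhf h
      exact hV.isTransferKrull hR.1 he
    tfae_have 2 → 3 := fun h => by
      obtain ⟨e, he⟩ := CK.IsValueHom.exists_atom_value_of_le fun _ _ =>
        hV.map_le_of_isTransferKrull h
      exact hV.isTransferHom_nonzeroInclusion hR.1 he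
    tfae_have 3 → 1 := fun h => by
      obtain ⟨e, he⟩ := CK.IsValueHom.exists_atom_value_of_le fun _ _ =>
        hV.map_le_of_isTransferHom h
      exact hV.isHalfFactorial hR.1 he
    tfae_finish
  · obtain ⟨e, he⟩ := hhf h
    constructor
    · refine Set.Subset.antisymm (fun x hx => CK.not_isUnit_of_mem_map_maximalIdeal hx)
        fun x hx => ?_
      obtain ⟨a, ha, y, rfl⟩ := hV.exists_eq_algebraMap_mul hR.1 he hx
      exact hmul_mem a ha y
    · refine Set.Subset.antisymm ?_ fun x hx => hV.exists_eq_algebraMap_mul hR.1 he hx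
      rintro _ ⟨a, ha, y, rfl⟩
      exact CK.not_isUnit_of_mem_map_maximalIdeal (hmul_mem a ha y)
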